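/- Equip $[0,1)$ with its Borel $\sigma$-algebra and Lebesgue measure $|\cdot|$. For $n\ge 0$ let $\mathcal D_n=\{[k/2^n,(k+1)/2^n): 0\le k<2^n\}$, let $\mathcal F_n$ be the $\sigma$-algebra on $[0,1)$ generated by $\mathcal D_n$, and call $A\subseteq[0,1)$ dyadic if $A\in\mathcal D:=\bigcup_{n\ge0}\mathcal F_n$. For an integrable $f:[0,1)\to\mathbb R$ let $f_n=\sum_{J\in\mathcal D_n}\mathbf 1_J\,\frac1{|J|}\int_J f$ and $$S_2(f)=\Big(\sum_{n\ge1}(f_n-f_{n-1})^2\Big)^{1/2}.$$ Let $\Phi(x)=\int_{-\infty}^x \frac{e^{-t^2/2}}{\sqrt{2\pi}}\,dt$, and let $I(x)=\Phi'(\Phi^{-1}(x))$ for $0<x<1$, $I(0)=I(1)=0$. Write $|A|^*=\min\{|A|,1-|A|\}$. **Theorem.** (i) For every dyadic set $A$, $$\|S_2(\mathbf 1_A)\|_{1}\ \ge\ I(|A|).$$ (ii) There is a universal constant $C>0$ such that for every dyadic set $A$, $$\|S_2(\mathbf 1_A)\|_{1}\ \ge\ C\,|A|^*\sqrt{\log\frac1{|A|^*}},$$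 where the right-hand side is read as $0$ when $|A|^*=0$. Here $\|g\|_1=\int_0^1|g(x)|\,dx$. -/

import Mathlib

open MeasureTheory Set

noncomputable section

namespace DyadicSquare

/-- The space `[0,1)`, with its Borel `σ`-algebra. -/
abbrev UnitIco : Type := Set.Ico (0 : ℝ) 1

/-- Lebesgue measure on `[0,1)`. -/
instance instMeasureSpaceUnitIco : MeasureSpace UnitIco where
  volume := Measure.comap (Subtype.val : UnitIco → ℝ) volume

/-- The `k`-th dyadic interval `[k / 2 ^ n, (k + 1) / 2 ^ n)` of level `n` in `[0,1)`. -/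
def dyadicInterval (n k : ℕ) : Set UnitIco :=
  {x | (k : ℝ) / 2 ^ n ≤ (x : ℝ) ∧ (x : ℝ) < ((k : ℝ) + 1) / 2 ^ n}

/-- The `σ`-algebra on `[0,1)` generated by the dyadic intervals of level `n`. -/
@[reducible]
def dyadicSigmaAlgebra (n : ℕ) : MeasurableSpace UnitIco :=
  MeasurableSpace.generateFrom {J | ∃ k : ℕ, k < 2 ^ n ∧ J = dyadicInterval n k}

/-- A dyadic set: a member of one of the dyadic `σ`-algebras. -/
def IsDyadicSet (A : Set UnitIco) : Prop :=
  ∃ n : ℕ, MeasurableSet[dyadicSigmaAlgebra n] A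

/-- The dyadic martingale generated by `f`: at level `n` it takes on each dyadic interval of
level `n` the average of `f` over this interval. -/
def dyadicMartingale (f : UnitIco → ℝ) (n : ℕ) (x : UnitIco) : ℝ :=
  ∑ k ∈ Finset.range (2 ^ n),
    (dyadicInterval n k).indicator (fun _ => ⨍ y in dyadicInterval n k, f y) x

/-- The dyadic square function `S₂(f) = (∑_{n ≥ 1} (f_n - f_{n-1}) ^ 2) ^ (1/2)`. For the
indicator of a dyadic set only finitely many terms of the series are nonzero. -/
def squareFunction (f : UnitIco → ℝ) (x : UnitIco) : ℝ :=
  Real.sqrt (∑' n : ℕ, (dyadicMartingale f (n + 1) x - dyadicMartingale f n x) ^ 2)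

/-- The standard Gaussian distribution function. -/
def gaussianPhi (x : ℝ) : ℝ :=
  ∫ t in Set.Iic x, Real.exp (-t ^ 2 / 2) / Real.sqrt (2 * Real.pi)

/-- The Gaussian isoperimetric profile `Φ' ∘ Φ⁻¹` on `(0,1)`, with the boundary values `0`
(its continuous extension) at `0` and `1`. `Φ` is a bijection of `ℝ` onto `(0,1)`, so `invFun`
is its inverse there. -/
def gaussianProfile (x : ℝ) : ℝ :=
  if x ∈ Set.Ioo (0 : ℝ) 1 then deriv gaussianPhi (Function.invFun gaussianPhi x) else 0

/-- `min {|A|, 1 - |A|}`, where `|A|` is the Lebesgue measure of `A`. -/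
def measureStar (A : Set UnitIco) : ℝ :=
  min (volume.real A) (1 - volume.real A)

end DyadicSquare

end

/-!
Write `I` for the Gaussian isoperimetric profile and `f_n` for the dyadic martingale of `1_A`.

The lower bound by `I(|A|)` comes from Bobkov's two-point inequality (`two_point`): for
`a, b ∈ [0,1]` and `d = (a - b) / 2`,
`2 I((a + b) / 2) ≤ √(I(a)² + d²) + √(I(b)² + d²)`.
Since `u ↦ √(u² + s)` is convex and increasing on `[0,∞)`, a term `s` may be added under all the
roots (`two_point_add`). Applied on each dyadic interval, with `a`, `b` the densities of `A` in its
halves and `s` the sum of the squared increments so far, this shows that the expectation of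
`√(I(f_n)² + ∑_{m ≤ n} (f_m - f_{m-1})²)` increases with `n` (`bobkovEnergy_le_succ`). It equals
`I(|A|)` at `n = 0`, and `‖S₂(1_A)‖₁` at a level at which `A` is a union of dyadic intervals,
because `I(0) = I(1) = 0`.

For the two-point inequality, put `c = (a + b) / 2` and `t = d`, with `c ≤ 1/2` by symmetry. After
squaring twice it reads
`(I(c + t)² - I(c - t)²)² ≤ 8 I(c)² (I(c + t)² + I(c - t)² + 2 t² - 2 I(c)²)`.
Everything follows from `I' = -Φ⁻¹` and `I I'' = -1`. The bracket on the right is at least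
`2 I'(c)² t²`, since its second derivative in `t` is `2 (I'(c + t)² + I'(c - t)²)` and `(I')²` is
convex (`sq_quantile_mul_sq_le`). The difference on the left lies between `0` and `4 I(c) I'(c) t`
(`sq_sub_sq_gaussianProfile_le`).

The logarithmic bound follows from the first one by estimating `I` from below. For `p ≤ 1/2` and
`z = -Φ⁻¹(p) ≥ 0`, concavity of `I` gives `I(p) ≥ p z` and `I(p) ≥ p / 2`, while
`p ≥ φ(z + 1)` gives `log (1 / p) ≤ 4 (1 + z)²`.
-/

namespace DyadicSquare

open Filter Topology

/-! ### The Gaussian distribution function and its inverse -/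

/-- The standard Gaussian density. -/
noncomputable def gaussianDensity (t : ℝ) : ℝ :=
  Real.exp (-t ^ 2 / 2) / Real.sqrt (2 * Real.pi)

lemma sqrt_two_pi_pos : 0 < Real.sqrt (2 * Real.pi) :=
  Real.sqrt_pos.2 (by positivity)

lemma gaussianDensity_pos (t : ℝ) : 0 < gaussianDensity t :=
  div_pos (Real.exp_pos _) sqrt_two_pi_pos

lemma gaussianDensity_neg (t : ℝ) : gaussianDensity (-t) = gaussianDensity t := by
  simp [gaussianDensity]

lemma hasDerivAt_gaussianDensity (t : ℝ) :
    HasDerivAt gaussianDensity (-t * gaussianDensity t) t := by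
  have h : HasDerivAt (fun t : ℝ => -t ^ 2 / 2) (-t) t := by
    have := ((hasDerivAt_pow 2 t).neg.div_const 2)
    convert! this using 1
    norm_num; ring
  convert! (h.exp.div_const (Real.sqrt (2 * Real.pi))) using 1
  unfold gaussianDensity; ring

lemma continuous_gaussianDensity : Continuous gaussianDensity :=
  continuous_iff_continuousAt.2 fun t => (hasDerivAt_gaussianDensity t).continuousAt

lemma gaussianDensity_le_of_abs_le {s t : ℝ} (h : |s| ≤ |t|) :
    gaussianDensity t ≤ gaussianDensity s := by
  have : s ^ 2 ≤ t ^ 2 := sq_le_sq.2 h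
  unfold gaussianDensity
  gcongr

lemma gaussianDensity_eq_gaussianPDFReal :
    gaussianDensity = ProbabilityTheory.gaussianPDFReal 0 1 := by
  ext t
  simp [gaussianDensity, ProbabilityTheory.gaussianPDFReal, div_eq_inv_mul]

lemma integrable_gaussianDensity : Integrable gaussianDensity := by
  rw [gaussianDensity_eq_gaussianPDFReal]
  exact ProbabilityTheory.integrable_gaussianPDFReal 0 1

lemma integral_gaussianDensity : ∫ t, gaussianDensity t = 1 := by
  rw [gaussianDensity_eq_gaussianPDFReal]
  exact ProbabilityTheory.integral_gaussianPDFReal_eq_one 0 one_ne_zero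

lemma gaussianPhi_eq_integral (x : ℝ) : gaussianPhi x = ∫ t in Iic x, gaussianDensity t := rfl

lemma gaussianPhi_eq_cdf (x : ℝ) :
    gaussianPhi x = ProbabilityTheory.cdf (ProbabilityTheory.gaussianReal 0 1) x := by
  rw [ProbabilityTheory.cdf_eq_real, measureReal_def,
    ProbabilityTheory.gaussianReal_apply_eq_integral _ one_ne_zero, gaussianPhi_eq_integral,
    gaussianDensity_eq_gaussianPDFReal, ENNReal.toReal_ofReal]
  exact integral_nonneg (ProbabilityTheory.gaussianPDFReal_nonneg 0 1)

lemma hasDerivAt_gaussianPhi (x : ℝ) : HasDerivAt gaussianPhi (gaussianDensity x) x := by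
  have h : gaussianPhi = fun y => gaussianPhi 0 + ∫ t in (0 : ℝ)..y, gaussianDensity t := by
    ext y
    have := intervalIntegral.integral_Iic_sub_Iic (a := 0) (b := y) (μ := volume)
      integrable_gaussianDensity.integrableOn integrable_gaussianDensity.integrableOn
    rw [gaussianPhi_eq_integral, gaussianPhi_eq_integral]
    linarith
  rw [h]
  exact (intervalIntegral.integral_hasDerivAt_right
    (continuous_gaussianDensity.intervalIntegrable _ _)
    (continuous_gaussianDensity.stronglyMeasurableAtFilter _ _)
    continuous_gaussianDensity.continuousAt).const_add _

lemma strictMono_gaussianPhi : StrictMono gaussianPhi :=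
  strictMono_of_hasDerivAt_pos hasDerivAt_gaussianPhi gaussianDensity_pos

lemma continuous_gaussianPhi : Continuous gaussianPhi :=
  continuous_iff_continuousAt.2 fun t => (hasDerivAt_gaussianPhi t).continuousAt

lemma tendsto_gaussianPhi_atTop : Tendsto gaussianPhi atTop (𝓝 1) := by
  rw [funext gaussianPhi_eq_cdf]
  exact ProbabilityTheory.tendsto_cdf_atTop _

lemma tendsto_gaussianPhi_atBot : Tendsto gaussianPhi atBot (𝓝 0) := by
  rw [funext gaussianPhi_eq_cdf]
  exact ProbabilityTheory.tendsto_cdf_atBot _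

lemma gaussianPhi_pos (x : ℝ) : 0 < gaussianPhi x := by
  have h : 0 ≤ gaussianPhi (x - 1) := by
    rw [gaussianPhi_eq_cdf]; exact ProbabilityTheory.cdf_nonneg _ _
  exact h.trans_lt (strictMono_gaussianPhi (by linarith))

lemma gaussianPhi_lt_one (x : ℝ) : gaussianPhi x < 1 := by
  have h : gaussianPhi (x + 1) ≤ 1 := by
    rw [gaussianPhi_eq_cdf]; exact ProbabilityTheory.cdf_le_one _ _
  exact (strictMono_gaussianPhi (by linarith)).trans_le h

lemma gaussianPhi_mem_Ioo (x : ℝ) : gaussianPhi x ∈ Ioo (0 : ℝ) 1 :=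
  ⟨gaussianPhi_pos x, gaussianPhi_lt_one x⟩

lemma gaussianPhi_neg (x : ℝ) : gaussianPhi (-x) = 1 - gaussianPhi x := by
  have h1 : gaussianPhi (-x) = ∫ t in Ioi x, gaussianDensity t := by
    rw [gaussianPhi_eq_integral, ← neg_neg x, ← integral_comp_neg_Iic]
    simp [gaussianDensity_neg]
  have h2 := intervalIntegral.integral_Iic_add_Ioi (b := x) (μ := volume)
      integrable_gaussianDensity.integrableOn integrable_gaussianDensity.integrableOn
  rw [integral_gaussianDensity] at h2
  rw [h1, gaussianPhi_eq_integral]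
  linarith

/-- The Gaussian quantile function `Φ⁻¹`, meaningful on `(0,1)`. -/
noncomputable def quantile (p : ℝ) : ℝ := Function.invFun gaussianPhi p

lemma quantile_gaussianPhi (x : ℝ) : quantile (gaussianPhi x) = x :=
  Function.leftInverse_invFun strictMono_gaussianPhi.injective x

lemma gaussianPhi_quantile {p : ℝ} (hp : p ∈ Ioo (0 : ℝ) 1) : gaussianPhi (quantile p) = p := by
  obtain ⟨a, ha⟩ := (tendsto_gaussianPhi_atBot.eventually_lt_const hp.1).exists
  obtain ⟨b, hb⟩ := (tendsto_gaussianPhi_atTop.eventually_const_lt hp.2).exists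
  exact Function.invFun_eq (mem_range_of_exists_le_of_exists_ge continuous_gaussianPhi
    ⟨a, ha.le⟩ ⟨b, hb.le⟩)

lemma strictMonoOn_quantile : StrictMonoOn quantile (Ioo 0 1) := fun p hp q hq h => by
  rwa [← strictMono_gaussianPhi.lt_iff_lt, gaussianPhi_quantile hp, gaussianPhi_quantile hq]

lemma quantile_one_sub {p : ℝ} (hp : p ∈ Ioo (0 : ℝ) 1) : quantile (1 - p) = -quantile p := by
  rw [← quantile_gaussianPhi (-quantile p), gaussianPhi_neg, gaussianPhi_quantile hp]

lemma continuousAt_quantile {p : ℝ} (hp : p ∈ Ioo (0 : ℝ) 1) : ContinuousAt quantile p := by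
  refine strictMonoOn_quantile.continuousAt_of_image_mem_nhds (Ioo_mem_nhds hp.1 hp.2) ?_
  have : quantile '' Ioo 0 1 = univ :=
    eq_univ_of_forall fun x => ⟨_, gaussianPhi_mem_Ioo x, quantile_gaussianPhi x⟩
  rw [this]
  exact univ_mem

lemma hasDerivAt_quantile {p : ℝ} (hp : p ∈ Ioo (0 : ℝ) 1) :
    HasDerivAt quantile (gaussianDensity (quantile p))⁻¹ p := by
  refine HasDerivAt.of_local_left_inverse (continuousAt_quantile hp)
    (hasDerivAt_gaussianPhi _) (gaussianDensity_pos _).ne' ?_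
  filter_upwards [Ioo_mem_nhds hp.1 hp.2] with q hq using gaussianPhi_quantile hq

/-! ### The Gaussian isoperimetric profile -/

lemma gaussianProfile_eq {p : ℝ} (hp : p ∈ Ioo (0 : ℝ) 1) :
    gaussianProfile p = gaussianDensity (quantile p) := by
  rw [gaussianProfile, if_pos hp, (hasDerivAt_gaussianPhi _).deriv, quantile]

lemma gaussianProfile_of_notMem {p : ℝ} (hp : p ∉ Ioo (0 : ℝ) 1) : gaussianProfile p = 0 :=
  if_neg hp

lemma gaussianProfile_pos {p : ℝ} (hp : p ∈ Ioo (0 : ℝ) 1) : 0 < gaussianProfile p := by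
  rw [gaussianProfile_eq hp]
  exact gaussianDensity_pos _

lemma gaussianProfile_nonneg (p : ℝ) : 0 ≤ gaussianProfile p := by
  by_cases hp : p ∈ Ioo (0 : ℝ) 1
  · exact (gaussianProfile_pos hp).le
  · rw [gaussianProfile_of_notMem hp]

lemma one_sub_mem_Ioo_iff {p : ℝ} : 1 - p ∈ Ioo (0 : ℝ) 1 ↔ p ∈ Ioo (0 : ℝ) 1 := by
  constructor <;> rintro ⟨h1, h2⟩ <;> constructor <;> linarith

lemma gaussianProfile_one_sub (p : ℝ) : gaussianProfile (1 - p) = gaussianProfile p := by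
  by_cases hp : p ∈ Ioo (0 : ℝ) 1
  · rw [gaussianProfile_eq hp, gaussianProfile_eq (one_sub_mem_Ioo_iff.2 hp), quantile_one_sub hp,
      gaussianDensity_neg]
  · rw [gaussianProfile_of_notMem hp, gaussianProfile_of_notMem (mt one_sub_mem_Ioo_iff.1 hp)]

/-- The profile satisfies `I' = -Φ⁻¹`; together with `(Φ⁻¹)' = 1 / I` this is the differential
equation `I I'' = -1`. -/
lemma hasDerivAt_gaussianProfile {p : ℝ} (hp : p ∈ Ioo (0 : ℝ) 1) :
    HasDerivAt gaussianProfile (-quantile p) p := by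
  have h := (hasDerivAt_gaussianDensity (quantile p)).comp p (hasDerivAt_quantile hp)
  rw [mul_assoc, mul_inv_cancel₀ (gaussianDensity_pos _).ne', mul_one] at h
  refine h.congr_of_eventuallyEq ?_
  filter_upwards [Ioo_mem_nhds hp.1 hp.2] with q hq using gaussianProfile_eq hq

lemma tendsto_gaussianDensity_atBot : Tendsto gaussianDensity atBot (𝓝 0) := by
  have h1 : Tendsto (fun t : ℝ => t ^ 2 / 2) atBot atTop :=
    (((tendsto_pow_atTop (α := ℝ) two_ne_zero).comp tendsto_abs_atBot_atTop).congr
      fun t => sq_abs t).atTop_div_const two_pos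
  have h2 := (Real.tendsto_exp_neg_atTop_nhds_zero.comp h1).div_const (Real.sqrt (2 * Real.pi))
  rw [zero_div] at h2
  refine h2.congr fun t => ?_
  simp [gaussianDensity, neg_div]

lemma continuousAt_gaussianProfile_zero : ContinuousAt gaussianProfile 0 := by
  rw [ContinuousAt, gaussianProfile_of_notMem (by simp), Metric.tendsto_nhds]
  intro ε hε
  obtain ⟨z, hz⟩ := eventually_atBot.1 (tendsto_gaussianDensity_atBot.eventually_lt_const hε)
  filter_upwards [Iio_mem_nhds (gaussianPhi_pos z)] with p hp
  rw [Real.dist_0_eq_abs, abs_of_nonneg (gaussianProfile_nonneg p)]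
  by_cases h : p ∈ Ioo (0 : ℝ) 1
  · rw [gaussianProfile_eq h]
    refine hz _ (strictMono_gaussianPhi.lt_iff_lt.1 ?_).le
    rwa [gaussianPhi_quantile h]
  · rwa [gaussianProfile_of_notMem h]

lemma continuous_gaussianProfile : Continuous gaussianProfile := by
  rw [continuous_iff_continuousAt]
  intro p
  have aux : ∀ q < 0, ContinuousAt gaussianProfile q := fun q hq => by
    refine (continuousAt_const (y := (0 : ℝ))).congr ?_
    filter_upwards [Iio_mem_nhds hq] with r hr
    exact (gaussianProfile_of_notMem fun h => (lt_asymm h.1 hr)).symm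
  have aux' : ∀ q ≤ 0, ContinuousAt gaussianProfile q := fun q hq => by
    rcases hq.lt_or_eq with h | rfl
    · exact aux q h
    · exact continuousAt_gaussianProfile_zero
  rcases le_or_gt p 0 with h0 | h0
  · exact aux' p h0
  rcases le_or_gt 1 p with h1 | h1
  · have hs : gaussianProfile = gaussianProfile ∘ fun q => 1 - q :=
      funext fun q => (gaussianProfile_one_sub q).symm
    rw [hs]
    exact (aux' (1 - p) (by linarith)).comp (by fun_prop)
  · exact (hasDerivAt_gaussianProfile ⟨h0, h1⟩).continuousAt

/-! ### The two-point inequality -/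

lemma le_of_hasDerivAt_nonneg {f f' : ℝ → ℝ} {r x : ℝ}
    (hf : ∀ t ∈ Ico 0 r, HasDerivAt f (f' t) t) (hf' : ∀ t ∈ Ico 0 r, 0 ≤ f' t)
    (hx : x ∈ Ico 0 r) : f 0 ≤ f x := by
  have hsub : Icc 0 x ⊆ Ico 0 r := fun t ht => ⟨ht.1, ht.2.trans_lt hx.2⟩
  refine monotoneOn_of_deriv_nonneg (convex_Icc 0 x)
    (fun t ht => (hf t (hsub ht)).continuousAt.continuousWithinAt)
    (fun t ht => (hf t (hsub (interior_subset ht))).differentiableAt.differentiableWithinAt)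
    (fun t ht => ?_) (left_mem_Icc.2 hx.1) (right_mem_Icc.2 hx.1) hx.1
  rw [(hf t (hsub (interior_subset ht))).deriv]
  exact hf' t (hsub (interior_subset ht))

lemma hasDerivAt_comp_add {f : ℝ → ℝ} {f' c t : ℝ} (h : HasDerivAt f f' (c + t)) :
    HasDerivAt (fun s => f (c + s)) f' t := by
  simpa using h.comp_const_add c t

lemma hasDerivAt_comp_sub {f : ℝ → ℝ} {f' c t : ℝ} (h : HasDerivAt f f' (c - t)) :
    HasDerivAt (fun s => f (c - s)) (-f') t := by
  simpa using h.comp_const_sub c t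

lemma monotone_div_gaussianDensity : Monotone fun z => z / gaussianDensity z := by
  refine monotone_of_hasDerivAt_nonneg
    (fun z => (hasDerivAt_id z).div (hasDerivAt_gaussianDensity z) (gaussianDensity_pos z).ne')
    fun z => ?_
  have := (gaussianDensity_pos z).le
  refine div_nonneg ?_ (sq_nonneg _)
  simp only [id]
  nlinarith [mul_nonneg (sq_nonneg z) this]

section

variable {c t : ℝ}

lemma quantile_half : quantile (1 / 2) = 0 := by
  have h := quantile_one_sub (p := 1 / 2) ⟨by norm_num, by norm_num⟩
  norm_num at h ⊢
  linarith

lemma quantile_nonpos (hc0 : 0 < c) (hc : c ≤ 1 / 2) : quantile c ≤ 0 := by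
  rw [← quantile_half]
  exact strictMonoOn_quantile.monotoneOn ⟨hc0, by linarith⟩ ⟨by norm_num, by norm_num⟩ hc

lemma add_mem_Ioo (hc : c ≤ 1 / 2) (ht : t ∈ Ico 0 c) : c + t ∈ Ioo (0 : ℝ) 1 :=
  ⟨by linarith [ht.1, ht.2], by linarith [ht.1, ht.2]⟩

lemma sub_mem_Ioo (hc : c ≤ 1 / 2) (ht : t ∈ Ico 0 c) : c - t ∈ Ioo (0 : ℝ) 1 :=
  ⟨by linarith [ht.1, ht.2], by linarith [ht.1, ht.2]⟩

lemma quantile_sub_le_add (hc : c ≤ 1 / 2) (ht : t ∈ Ico 0 c) :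
    quantile (c - t) ≤ quantile (c + t) :=
  strictMonoOn_quantile.monotoneOn (sub_mem_Ioo hc ht) (add_mem_Ioo hc ht) (by linarith [ht.1])

lemma abs_quantile_add_le (hc : c ≤ 1 / 2) (ht : t ∈ Ico 0 c) :
    |quantile (c + t)| ≤ |quantile (c - t)| := by
  have h1 := quantile_sub_le_add hc ht
  have h2 : quantile (c + t) ≤ quantile (1 - (c - t)) :=
    strictMonoOn_quantile.monotoneOn (add_mem_Ioo hc ht)
      (one_sub_mem_Ioo_iff.2 (sub_mem_Ioo hc ht)) (by linarith)
  rw [quantile_one_sub (sub_mem_Ioo hc ht)] at h2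
  exact (abs_le.2 ⟨by linarith, h2⟩).trans (neg_le_abs _)

/-- Midpoint convexity of `(I')² = (Φ⁻¹)²`: its derivative `2 z / φ(z)`, at `z = Φ⁻¹`, is
increasing. -/
lemma two_mul_sq_quantile_le (hc : c ≤ 1 / 2) (ht : t ∈ Ico 0 c) :
    2 * quantile c ^ 2 ≤ quantile (c + t) ^ 2 + quantile (c - t) ^ 2 := by
  have h := le_of_hasDerivAt_nonneg (r := c)
    (f := fun t => quantile (c + t) ^ 2 + quantile (c - t) ^ 2)
    (fun s hs => ((hasDerivAt_comp_add (hasDerivAt_quantile (add_mem_Ioo hc hs))).pow 2).add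
      ((hasDerivAt_comp_sub (hasDerivAt_quantile (sub_mem_Ioo hc hs))).pow 2))
    (fun s hs => ?_) ht
  · simp only [add_zero, sub_zero] at h
    linarith
  · have := monotone_div_gaussianDensity (quantile_sub_le_add hc hs)
    simp only [div_eq_mul_inv] at this
    norm_num
    nlinarith

lemma hasDerivAt_sq_gaussianProfile {p : ℝ} (hp : p ∈ Ioo (0 : ℝ) 1) :
    HasDerivAt (fun q => gaussianProfile q ^ 2) (-2 * (gaussianProfile p * quantile p)) p := by
  refine ((hasDerivAt_gaussianProfile hp).pow 2).congr_deriv ?_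
  norm_num; ring

lemma hasDerivAt_gaussianProfile_mul_quantile {p : ℝ} (hp : p ∈ Ioo (0 : ℝ) 1) :
    HasDerivAt (fun q => gaussianProfile q * quantile q) (1 - quantile p ^ 2) p := by
  refine ((hasDerivAt_gaussianProfile hp).mul (hasDerivAt_quantile hp)).congr_deriv ?_
  rw [gaussianProfile_eq hp, mul_inv_cancel₀ (gaussianDensity_pos _).ne']
  ring

/-- Second order lower bound for the symmetrization of `I² + x²` about `c`, from
`(I² + x²)'' = 2 (I')²` and the convexity of `(I')²`. -/
lemma sq_quantile_mul_sq_le (hc : c ≤ 1 / 2) (ht : t ∈ Ico 0 c) :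
    2 * quantile c ^ 2 * t ^ 2 ≤ gaussianProfile (c + t) ^ 2 + gaussianProfile (c - t) ^ 2
      + 2 * t ^ 2 - 2 * gaussianProfile c ^ 2 := by
  have first : ∀ s ∈ Ico 0 c, 0 ≤ -2 * (gaussianProfile (c + s) * quantile (c + s))
      + 2 * (gaussianProfile (c - s) * quantile (c - s)) + (4 - 4 * quantile c ^ 2) * s := by
    intro s hs
    have h := le_of_hasDerivAt_nonneg (r := c)
      (f := fun s => -2 * (gaussianProfile (c + s) * quantile (c + s))
        + 2 * (gaussianProfile (c - s) * quantile (c - s)) + (4 - 4 * quantile c ^ 2) * s)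
      (fun s hs => (((hasDerivAt_comp_add (hasDerivAt_gaussianProfile_mul_quantile
          (add_mem_Ioo hc hs))).const_mul (-2)).add
        ((hasDerivAt_comp_sub (hasDerivAt_gaussianProfile_mul_quantile
          (sub_mem_Ioo hc hs))).const_mul 2)).add
        ((hasDerivAt_id s).const_mul (4 - 4 * quantile c ^ 2)))
      (fun s hs => ?_) hs
    · simp only [add_zero, sub_zero, mul_zero] at h
      linarith
    · linarith [two_mul_sq_quantile_le hc hs]
  have h := le_of_hasDerivAt_nonneg (r := c)
    (f := fun s => gaussianProfile (c + s) ^ 2 + gaussianProfile (c - s) ^ 2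
      + (2 - 2 * quantile c ^ 2) * s ^ 2)
    (fun s hs => ((hasDerivAt_comp_add (hasDerivAt_sq_gaussianProfile
          (add_mem_Ioo hc hs))).add
        (hasDerivAt_comp_sub (hasDerivAt_sq_gaussianProfile
          (sub_mem_Ioo hc hs)))).add
        ((hasDerivAt_pow 2 s).const_mul (2 - 2 * quantile c ^ 2)))
    (fun s hs => ?_) ht
  · simp only [add_zero, sub_zero] at h
    linarith
  · have := first s hs
    norm_num
    linarith

/-- First order upper bound for the antisymmetrization of `I²`: with `J = I²`, the derivative
`J'(c + t) + J'(c - t)` decreases in `t`, because `J'' = 2 (I')² - 2` and `|I'|` is larger at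
`c - t` than at `c + t`. -/
lemma sq_sub_sq_gaussianProfile_le (hc : c ≤ 1 / 2) (ht : t ∈ Ico 0 c) :
    gaussianProfile (c + t) ^ 2 - gaussianProfile (c - t) ^ 2
      ≤ -4 * (gaussianProfile c * quantile c) * t := by
  have first : ∀ s ∈ Ico 0 c, 0 ≤ 2 * (gaussianProfile (c + s) * quantile (c + s))
      + 2 * (gaussianProfile (c - s) * quantile (c - s))
      - 4 * (gaussianProfile c * quantile c) := by
    intro s hs
    have h := le_of_hasDerivAt_nonneg (r := c)
      (f := fun s => 2 * (gaussianProfile (c + s) * quantile (c + s))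
        + 2 * (gaussianProfile (c - s) * quantile (c - s)))
      (fun s hs => ((hasDerivAt_comp_add (hasDerivAt_gaussianProfile_mul_quantile
          (add_mem_Ioo hc hs))).const_mul 2).add
        ((hasDerivAt_comp_sub (hasDerivAt_gaussianProfile_mul_quantile
          (sub_mem_Ioo hc hs))).const_mul 2))
      (fun s hs => ?_) hs
    · simp only [add_zero, sub_zero] at h
      linarith
    · linarith [sq_le_sq.2 (abs_quantile_add_le hc hs)]
  have h := le_of_hasDerivAt_nonneg (r := c)
    (f := fun s => gaussianProfile (c - s) ^ 2 - gaussianProfile (c + s) ^ 2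
      + (-4 * (gaussianProfile c * quantile c)) * s)
    (fun s hs => ((hasDerivAt_comp_sub (hasDerivAt_sq_gaussianProfile
          (sub_mem_Ioo hc hs))).sub
        (hasDerivAt_comp_add (hasDerivAt_sq_gaussianProfile
          (add_mem_Ioo hc hs)))).add
        ((hasDerivAt_id s).const_mul (-4 * (gaussianProfile c * quantile c))))
    (fun s hs => ?_) ht
  · simp only [add_zero, sub_zero, mul_zero] at h
    linarith
  · linarith [first s hs]

lemma gaussianProfile_sub_le_add (hc : c ≤ 1 / 2) (ht : t ∈ Ico 0 c) :
    gaussianProfile (c - t) ≤ gaussianProfile (c + t) := by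
  rw [gaussianProfile_eq (add_mem_Ioo hc ht), gaussianProfile_eq (sub_mem_Ioo hc ht)]
  exact gaussianDensity_le_of_abs_le (abs_quantile_add_le hc ht)

end

/-- The elementary inequality behind the two-point inequality, for `u`, `v` the two square roots
and `m` the value at the midpoint. -/
lemma two_mul_le_add_of_sq {u v m : ℝ} (hu : 0 ≤ u) (hv : 0 ≤ v)
    (h : (u ^ 2 - v ^ 2) ^ 2 ≤ 8 * m ^ 2 * (u ^ 2 + v ^ 2 - 2 * m ^ 2)) : 2 * m ≤ u + v := by
  by_contra! hlt
  have h1 : (u + v) ^ 2 < 4 * m ^ 2 := by nlinarith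
  have h2 : (u - v) ^ 2 < 4 * m ^ 2 := by nlinarith [mul_nonneg hu hv]
  -- the hypothesis says that `((u + v)² - 4 m²) ((u - v)² - 4 m²) ≤ 0`
  nlinarith [mul_pos (sub_pos.2 h1) (sub_pos.2 h2)]

lemma two_point_aux {c t : ℝ} (hc : c ≤ 1 / 2) (ht : t ∈ Ico 0 c) :
    2 * gaussianProfile c ≤ Real.sqrt (gaussianProfile (c + t) ^ 2 + t ^ 2)
      + Real.sqrt (gaussianProfile (c - t) ^ 2 + t ^ 2) := by
  refine two_mul_le_add_of_sq (Real.sqrt_nonneg _) (Real.sqrt_nonneg _) ?_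
  rw [Real.sq_sqrt (by positivity), Real.sq_sqrt (by positivity)]
  have h1 := sq_quantile_mul_sq_le hc ht
  have h2 := sq_sub_sq_gaussianProfile_le hc ht
  have h3 : 0 ≤ gaussianProfile (c + t) ^ 2 - gaussianProfile (c - t) ^ 2 :=
    sub_nonneg.2 (pow_le_pow_left₀ (gaussianProfile_nonneg _) (gaussianProfile_sub_le_add hc ht) 2)
  have h4 := pow_le_pow_left₀ h3 h2 2
  have h5 := mul_le_mul_of_nonneg_left h1 (by positivity : 0 ≤ 8 * gaussianProfile c ^ 2)
  nlinarith

/-- Bobkov's two-point inequality. -/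
theorem two_point {a b : ℝ} (ha : a ∈ Icc (0 : ℝ) 1) (hb : b ∈ Icc (0 : ℝ) 1) :
    2 * gaussianProfile ((a + b) / 2) ≤ Real.sqrt (gaussianProfile a ^ 2 + ((a - b) / 2) ^ 2)
      + Real.sqrt (gaussianProfile b ^ 2 + ((a - b) / 2) ^ 2) := by
  have ordered : ∀ a b : ℝ, a ∈ Ioo (0 : ℝ) 1 → b ∈ Ioo (0 : ℝ) 1 → b ≤ a → a + b ≤ 1 →
      2 * gaussianProfile ((a + b) / 2) ≤ Real.sqrt (gaussianProfile a ^ 2 + ((a - b) / 2) ^ 2)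
        + Real.sqrt (gaussianProfile b ^ 2 + ((a - b) / 2) ^ 2) := by
    intro a b ha hb hab hle
    have h := two_point_aux (c := (a + b) / 2) (t := (a - b) / 2) (by linarith)
      ⟨by linarith, by linarith [hb.1]⟩
    rwa [show (a + b) / 2 + (a - b) / 2 = a by ring,
      show (a + b) / 2 - (a - b) / 2 = b by ring] at h
  have half : ∀ a b : ℝ, a ∈ Ioo (0 : ℝ) 1 → b ∈ Ioo (0 : ℝ) 1 → b ≤ a →
      2 * gaussianProfile ((a + b) / 2) ≤ Real.sqrt (gaussianProfile a ^ 2 + ((a - b) / 2) ^ 2)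
        + Real.sqrt (gaussianProfile b ^ 2 + ((a - b) / 2) ^ 2) := by
    intro a b ha hb hab
    rcases le_total (a + b) 1 with h | h
    · exact ordered a b ha hb hab h
    · have := ordered (1 - b) (1 - a) (one_sub_mem_Ioo_iff.2 hb) (one_sub_mem_Ioo_iff.2 ha)
        (by linarith) (by linarith)
      rwa [show (1 - b + (1 - a)) / 2 = 1 - (a + b) / 2 by ring,
        show 1 - b - (1 - a) = a - b by ring, gaussianProfile_one_sub, gaussianProfile_one_sub,
        gaussianProfile_one_sub, add_comm (Real.sqrt _)] at this
  -- the inequality is closed in `(a, b)`, so it passes from the open to the closed square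
  have hclosed : IsClosed {p : ℝ × ℝ | 2 * gaussianProfile ((p.1 + p.2) / 2)
      ≤ Real.sqrt (gaussianProfile p.1 ^ 2 + ((p.1 - p.2) / 2) ^ 2)
      + Real.sqrt (gaussianProfile p.2 ^ 2 + ((p.1 - p.2) / 2) ^ 2)} := by
    have := continuous_gaussianProfile
    refine isClosed_le ?_ ?_ <;> fun_prop
  have hsub := closure_minimal (s := Ioo (0 : ℝ) 1 ×ˢ Ioo (0 : ℝ) 1) (fun p hp => ?_) hclosed
  · rw [closure_prod_eq, closure_Ioo zero_ne_one] at hsub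
    exact hsub (mk_mem_prod ha hb)
  · rcases le_total p.2 p.1 with h | h
    · exact half _ _ hp.1 hp.2 h
    · have := half _ _ hp.2 hp.1 h
      rwa [add_comm p.2, add_comm (Real.sqrt _), ← neg_sub p.1 p.2, neg_div, neg_sq] at this

/-- The two-point inequality with an extra additive term `s` under the square roots: this is what
an inductive use along a martingale needs. -/
theorem two_point_add {a b s : ℝ} (ha : a ∈ Icc (0 : ℝ) 1) (hb : b ∈ Icc (0 : ℝ) 1)
    (hs : 0 ≤ s) :
    2 * Real.sqrt (gaussianProfile ((a + b) / 2) ^ 2 + s)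
      ≤ Real.sqrt (gaussianProfile a ^ 2 + (s + ((a - b) / 2) ^ 2))
      + Real.sqrt (gaussianProfile b ^ 2 + (s + ((a - b) / 2) ^ 2)) := by
  have key : ∀ m u v : ℝ, 0 ≤ m → 0 ≤ u → 0 ≤ v → 2 * m ≤ u + v →
      2 * Real.sqrt (m ^ 2 + s) ≤ Real.sqrt (u ^ 2 + s) + Real.sqrt (v ^ 2 + s) := by
    intro m u v hm hu hv h
    have hus := Real.sq_sqrt (add_nonneg (sq_nonneg u) hs)
    have hvs := Real.sq_sqrt (add_nonneg (sq_nonneg v) hs)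
    have hprod : u * v + s ≤ Real.sqrt (u ^ 2 + s) * Real.sqrt (v ^ 2 + s) := by
      rw [← Real.sqrt_mul (by positivity)]
      refine Real.le_sqrt_of_sq_le ?_
      nlinarith [mul_nonneg hs (sq_nonneg (u - v))]
    have : Real.sqrt (m ^ 2 + s) ≤ (Real.sqrt (u ^ 2 + s) + Real.sqrt (v ^ 2 + s)) / 2 := by
      refine Real.sqrt_le_iff.2 ⟨by positivity, ?_⟩
      nlinarith [pow_le_pow_left₀ (by positivity : 0 ≤ 2 * m) h 2]
    linarith
  have h := key _ _ _ (gaussianProfile_nonneg _) (Real.sqrt_nonneg _) (Real.sqrt_nonneg _)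
    (two_point ha hb)
  rw [Real.sq_sqrt (by positivity), Real.sq_sqrt (by positivity)] at h
  convert h using 3 <;> ring_nf

/-! ### A lower bound for the profile -/

lemma quantile_mul_le_gaussianProfile {p : ℝ} (hp : p ∈ Ioo (0 : ℝ) 1) :
    -quantile p * p ≤ gaussianProfile p := by
  obtain ⟨ξ, hξ, h⟩ := exists_hasDerivAt_eq_slope gaussianProfile (fun q => -quantile q) hp.1
    continuous_gaussianProfile.continuousOn
    fun q hq => hasDerivAt_gaussianProfile ⟨hq.1, hq.2.trans hp.2⟩
  rw [gaussianProfile_of_notMem (p := 0) (by simp), sub_zero, sub_zero, eq_div_iff hp.1.ne'] at h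
  rw [← h]
  have := strictMonoOn_quantile ⟨hξ.1, hξ.2.trans hp.2⟩ hp hξ.2
  nlinarith [hp.1]

lemma concaveOn_gaussianProfile : ConcaveOn ℝ (Icc 0 1) gaussianProfile := by
  refine AntitoneOn.concaveOn_of_deriv (convex_Icc 0 1) continuous_gaussianProfile.continuousOn
    ?_ ?_ <;> rw [interior_Icc]
  · exact fun p hp => (hasDerivAt_gaussianProfile hp).differentiableAt.differentiableWithinAt
  · intro p hp q hq h
    rw [(hasDerivAt_gaussianProfile hp).deriv, (hasDerivAt_gaussianProfile hq).deriv]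
    exact neg_le_neg (strictMonoOn_quantile.monotoneOn hp hq h)

lemma half_mul_le_gaussianProfile {p : ℝ} (hp0 : 0 < p) (hp : p ≤ 1 / 2) :
    p / 2 ≤ gaussianProfile p := by
  have h := concaveOn_gaussianProfile.2 (left_mem_Icc.2 zero_le_one)
    (⟨by norm_num, by norm_num⟩ : (1 / 2 : ℝ) ∈ Icc 0 1)
    (by linarith : 0 ≤ 1 - 2 * p) (by linarith : 0 ≤ 2 * p) (by ring)
  rw [gaussianProfile_of_notMem (p := 0) (by simp), smul_zero, smul_eq_mul, smul_eq_mul,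
    gaussianProfile_eq (by constructor <;> norm_num), quantile_half] at h
  have h1 : 1 / 4 ≤ gaussianDensity 0 := by
    simp only [gaussianDensity, ne_eq, OfNat.ofNat_ne_zero, not_false_eq_true, zero_pow, neg_zero,
      zero_div, Real.exp_zero]
    refine one_div_le_one_div_of_le sqrt_two_pi_pos (Real.sqrt_le_iff.2 ⟨by norm_num, ?_⟩)
    nlinarith [Real.pi_le_four]
  rw [zero_add, zero_add, show 2 * p * (1 / 2) = p by ring] at h
  nlinarith

/-- `log (1 / p)` grows at most quadratically in the quantile: `p = Φ(-z)` is at least `φ(z + 1)`,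
by the mean value theorem on `[-z - 1, -z]`. -/
lemma log_one_div_le {p : ℝ} (hp0 : 0 < p) (hp : p ≤ 1 / 2) :
    Real.log (1 / p) ≤ (2 * (1 - quantile p)) ^ 2 := by
  have hmem : p ∈ Ioo (0 : ℝ) 1 := ⟨hp0, by linarith⟩
  set z := quantile p with hz
  have hz0 : z ≤ 0 := quantile_nonpos hp0 hp
  obtain ⟨ξ, hξ, h⟩ := exists_hasDerivAt_eq_slope gaussianPhi gaussianDensity
    (sub_one_lt z) continuous_gaussianPhi.continuousOn fun q _ => hasDerivAt_gaussianPhi q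
  rw [hz, gaussianPhi_quantile hmem, ← hz, sub_sub_cancel, div_one] at h
  have h1 : gaussianDensity (z - 1) ≤ p := by
    have h2 : gaussianDensity (z - 1) ≤ gaussianDensity ξ := gaussianDensity_le_of_abs_le (by
      rw [abs_of_nonpos (by linarith [hξ.2]), abs_of_nonpos (by linarith)]
      linarith [hξ.1])
    linarith [gaussianPhi_pos (z - 1)]
  have h3 : Real.exp (-(2 * (1 - z)) ^ 2) ≤ gaussianDensity (z - 1) := by
    have h4 : Real.sqrt (2 * Real.pi) ≤ Real.exp 3 := by
      refine Real.sqrt_le_iff.2 ⟨(Real.exp_pos _).le, ?_⟩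
      nlinarith [Real.pi_le_four, Real.add_one_le_exp 3]
    rw [gaussianDensity, le_div_iff₀ sqrt_two_pi_pos]
    calc _ ≤ Real.exp (-(2 * (1 - z)) ^ 2) * Real.exp 3 := by gcongr
      _ = Real.exp (-(2 * (1 - z)) ^ 2 + 3) := (Real.exp_add _ _).symm
      _ ≤ _ := Real.exp_le_exp.2 (by nlinarith)
  rw [one_div, Real.log_inv, neg_le, Real.le_log_iff_exp_le hp0]
  exact h3.trans h1

/-- Comparison of the profile with `p √(log (1 / p))`, in a form symmetric under `p ↦ 1 - p`. -/
theorem mul_sqrt_log_le_gaussianProfile {p : ℝ} (hp : p ∈ Icc (0 : ℝ) 1) :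
    1 / 6 * (min p (1 - p) * Real.sqrt (Real.log (1 / min p (1 - p)))) ≤ gaussianProfile p := by
  have main : ∀ q : ℝ, 0 ≤ q → q ≤ 1 / 2 →
      1 / 6 * (q * Real.sqrt (Real.log (1 / q))) ≤ gaussianProfile q := by
    intro q hq0 hq
    rcases hq0.eq_or_lt with rfl | hq0
    · simpa using gaussianProfile_nonneg 0
    have h1 := quantile_mul_le_gaussianProfile (p := q) ⟨hq0, by linarith⟩
    have h2 := half_mul_le_gaussianProfile hq0 hq
    have h3 := Real.sqrt_le_sqrt (log_one_div_le hq0 hq)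
    rw [Real.sqrt_sq (by linarith [quantile_nonpos hq0 hq])] at h3
    have h4 := mul_le_mul_of_nonneg_left h3 hq0.le
    linarith
  rcases le_total p (1 - p) with h | h
  · rw [min_eq_left h]
    exact main p hp.1 (by linarith)
  · rw [min_eq_right h, ← gaussianProfile_one_sub]
    exact main _ (by linarith [hp.2]) (by linarith)

/-! ### Dyadic intervals -/

/-- The index `k` of the dyadic interval of level `n` that contains `x`. -/
noncomputable def dyadicIndex (n : ℕ) (x : UnitIco) : ℕ := ⌊(x : ℝ) * 2 ^ n⌋₊

lemma mem_dyadicInterval_iff {n k : ℕ} {x : UnitIco} :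
    x ∈ dyadicInterval n k ↔ dyadicIndex n x = k := by
  have h2 : (0 : ℝ) < 2 ^ n := by positivity
  rw [dyadicIndex, Nat.floor_eq_iff (mul_nonneg x.2.1 h2.le), dyadicInterval, mem_ofPred_eq,
    div_le_iff₀ h2, lt_div_iff₀ h2]

lemma dyadicInterval_eq_preimage (n k : ℕ) : dyadicInterval n k = dyadicIndex n ⁻¹' {k} :=
  Set.ext fun _ => mem_dyadicInterval_iff

lemma dyadicIndex_lt (n : ℕ) (x : UnitIco) : dyadicIndex n x < 2 ^ n := by
  rw [dyadicIndex, Nat.floor_lt (mul_nonneg x.2.1 (by positivity))]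
  push_cast
  have := mul_lt_mul_of_pos_right x.2.2 (by positivity : (0 : ℝ) < 2 ^ n)
  rwa [one_mul] at this

lemma dyadicIndex_succ_div_two (n : ℕ) (x : UnitIco) :
    dyadicIndex (n + 1) x / 2 = dyadicIndex n x := by
  rw [dyadicIndex, dyadicIndex, ← Nat.floor_div_ofNat]
  congr 1
  rw [pow_succ]
  simp [← mul_assoc]

lemma measurable_dyadicIndex (n : ℕ) : Measurable (dyadicIndex n) :=
  Nat.measurable_floor.comp (measurable_subtype_coe.mul_const _)

lemma measurableSet_dyadicInterval (n k : ℕ) : MeasurableSet (dyadicInterval n k) := by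
  rw [dyadicInterval_eq_preimage]
  exact measurable_dyadicIndex n (measurableSet_singleton k)

lemma volume_eq_volume_image (s : Set UnitIco) :
    volume s = volume ((Subtype.val : UnitIco → ℝ) '' s) :=
  (MeasurableEmbedding.subtype_coe measurableSet_Ico).comap_apply _ _

lemma volume_univ_unitIco : volume (univ : Set UnitIco) = 1 := by
  rw [volume_eq_volume_image, image_univ, Subtype.range_coe]
  simp

instance isProbabilityMeasure_volume_unitIco : IsProbabilityMeasure (volume : Measure UnitIco) :=
  ⟨volume_univ_unitIco⟩

lemma volume_real_dyadicInterval {n k : ℕ} (hk : k < 2 ^ n) :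
    volume.real (dyadicInterval n k) = (2 ^ n)⁻¹ := by
  have h2 : (0 : ℝ) < 2 ^ n := by positivity
  have : (Subtype.val : UnitIco → ℝ) '' dyadicInterval n k
      = Ico ((k : ℝ) / 2 ^ n) (((k : ℝ) + 1) / 2 ^ n) := by
    ext x
    constructor
    · rintro ⟨y, hy, rfl⟩
      exact hy
    · intro hx
      have hk' : (k : ℝ) + 1 ≤ 2 ^ n := by exact_mod_cast hk
      exact ⟨⟨x, (by positivity : (0 : ℝ) ≤ k / 2 ^ n).trans hx.1,
        hx.2.trans_le ((div_le_one h2).2 hk')⟩, hx, rfl⟩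
  rw [measureReal_def, volume_eq_volume_image, this, Real.volume_Ico, ENNReal.toReal_ofReal]
  · ring
  · rw [← sub_div]
    simp

lemma dyadicInterval_eq_empty {n k : ℕ} (hk : ¬ k < 2 ^ n) : dyadicInterval n k = ∅ :=
  eq_empty_of_forall_notMem fun x hx => hk (mem_dyadicInterval_iff.1 hx ▸ dyadicIndex_lt n x)

/-- A dyadic set is, at every sufficiently fine level, a union of dyadic intervals. -/
lemma IsDyadicSet.exists_preimage {A : Set UnitIco} (hA : IsDyadicSet A) :
    ∃ N, ∀ n ≥ N, ∃ T : Set ℕ, A = dyadicIndex n ⁻¹' T := by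
  obtain ⟨N, hN⟩ := hA
  refine ⟨N, fun n hn => ?_⟩
  induction n, hn using Nat.le_induction with
  | base =>
    have hle : dyadicSigmaAlgebra N ≤ MeasurableSpace.comap (dyadicIndex N) ⊤ := by
      refine MeasurableSpace.generateFrom_le ?_
      rintro _ ⟨k, -, rfl⟩
      exact ⟨{k}, trivial, (dyadicInterval_eq_preimage N k).symm⟩
    obtain ⟨T, -, hT⟩ := hle A hN
    exact ⟨T, hT.symm⟩
  | succ n _ ih =>
    obtain ⟨T, rfl⟩ := ih
    refine ⟨{k | k / 2 ∈ T}, ?_⟩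
    ext x
    simp [dyadicIndex_succ_div_two]

lemma IsDyadicSet.measurableSet {A : Set UnitIco} (hA : IsDyadicSet A) : MeasurableSet A := by
  obtain ⟨N, hN⟩ := hA.exists_preimage
  obtain ⟨T, rfl⟩ := hN N le_rfl
  exact measurable_dyadicIndex N (MeasurableSet.of_discrete)

lemma integral_comp_dyadicIndex (n : ℕ) (g : ℕ → ℝ) :
    ∫ x, g (dyadicIndex n x) = (∑ k ∈ Finset.range (2 ^ n), g k) / 2 ^ n := by
  have h : ∀ x, g (dyadicIndex n x)
      = ∑ k ∈ Finset.range (2 ^ n), (dyadicInterval n k).indicator (fun _ => g k) x := by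
    intro x
    rw [Finset.sum_eq_single_of_mem _ (Finset.mem_range.2 (dyadicIndex_lt n x)),
      indicator_of_mem (mem_dyadicInterval_iff.2 rfl)]
    intro k _ hk
    exact indicator_of_notMem (fun hx => hk (mem_dyadicInterval_iff.1 hx).symm) _
  simp_rw [h]
  rw [integral_finsetSum _ fun k _ =>
    (integrable_const (g k)).indicator (measurableSet_dyadicInterval n k), Finset.sum_div]
  refine Finset.sum_congr rfl fun k hk => ?_
  rw [integral_indicator_const _ (measurableSet_dyadicInterval n k),
    volume_real_dyadicInterval (Finset.mem_range.1 hk), smul_eq_mul, div_eq_inv_mul]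

/-! ### The dyadic martingale of an indicator -/

/-- The density of `A` in the `k`-th dyadic interval of level `n`; it is `0` for `2 ^ n ≤ k`,
where that interval is empty. -/
noncomputable def dyadicDensity (A : Set UnitIco) (n k : ℕ) : ℝ :=
  2 ^ n * volume.real (A ∩ dyadicInterval n k)

lemma dyadicDensity_mem_Icc (A : Set UnitIco) (n k : ℕ) :
    dyadicDensity A n k ∈ Icc (0 : ℝ) 1 := by
  refine ⟨by unfold dyadicDensity; positivity, ?_⟩
  by_cases hk : k < 2 ^ n
  · have h := measureReal_mono (μ := volume) (inter_subset_right (s := A) (t := dyadicInterval n k))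
    rw [volume_real_dyadicInterval hk] at h
    calc _ ≤ (2 : ℝ) ^ n * (2 ^ n)⁻¹ := by unfold dyadicDensity; gcongr
      _ = 1 := mul_inv_cancel₀ (by positivity)
  · simp [dyadicDensity, dyadicInterval_eq_empty hk]

lemma dyadicDensity_zero_zero (A : Set UnitIco) : dyadicDensity A 0 0 = volume.real A := by
  have : dyadicInterval 0 0 = univ := eq_univ_of_forall fun x =>
    mem_dyadicInterval_iff.2 (Nat.lt_one_iff.1 (dyadicIndex_lt 0 x))
  simp [dyadicDensity, this]

lemma dyadicDensity_eq_average {A : Set UnitIco} (hA : MeasurableSet A) (n k : ℕ) :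
    dyadicDensity A n k
      = (dyadicDensity A (n + 1) (2 * k) + dyadicDensity A (n + 1) (2 * k + 1)) / 2 := by
  have hU : A ∩ dyadicInterval n k
      = A ∩ dyadicInterval (n + 1) (2 * k) ∪ A ∩ dyadicInterval (n + 1) (2 * k + 1) := by
    ext x
    simp only [mem_inter_iff, mem_union, mem_dyadicInterval_iff, ← dyadicIndex_succ_div_two n x]
    rw [← and_or_left]
    exact and_congr_right fun _ => by omega
  have hd : Disjoint (A ∩ dyadicInterval (n + 1) (2 * k))
      (A ∩ dyadicInterval (n + 1) (2 * k + 1)) := by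
    refine disjoint_left.2 fun x hx hy => ?_
    have h1 := mem_dyadicInterval_iff.1 hx.2
    have h2 := mem_dyadicInterval_iff.1 hy.2
    omega
  simp only [dyadicDensity]
  rw [hU, measureReal_union hd (hA.inter (measurableSet_dyadicInterval _ _))]
  ring

lemma dyadicDensity_preimage (T : Set ℕ) [DecidablePred (· ∈ T)] {n k : ℕ} (hk : k < 2 ^ n) :
    dyadicDensity (dyadicIndex n ⁻¹' T) n k = if k ∈ T then 1 else 0 := by
  rw [dyadicDensity, dyadicInterval_eq_preimage, ← preimage_inter]
  split_ifs with h
  · rw [inter_eq_right.2 (singleton_subset_iff.2 h), ← dyadicInterval_eq_preimage,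
      volume_real_dyadicInterval hk, mul_inv_cancel₀ (by positivity)]
  · simp [inter_singleton_eq_empty.2 h]

lemma dyadicMartingale_indicator {A : Set UnitIco} (hA : MeasurableSet A) (n : ℕ) (x : UnitIco) :
    dyadicMartingale (A.indicator fun _ => 1) n x = dyadicDensity A n (dyadicIndex n x) := by
  have hlt := dyadicIndex_lt n x
  rw [dyadicMartingale, Finset.sum_eq_single_of_mem _ (Finset.mem_range.2 hlt),
    indicator_of_mem (mem_dyadicInterval_iff.2 rfl), setAverage_eq, integral_indicator_const _ hA,
    measureReal_restrict_apply hA, volume_real_dyadicInterval hlt, inv_inv, smul_eq_mul,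
    smul_eq_mul, mul_one, dyadicDensity]
  intro k _ hk
  exact indicator_of_notMem (fun hx => hk (mem_dyadicInterval_iff.1 hx).symm) _

/-- The sum of the squared martingale increments up to level `n`, on the `k`-th dyadic interval
of level `n`. -/
noncomputable def squareSum (A : Set UnitIco) : ℕ → ℕ → ℝ
  | 0, _ => 0
  | n + 1, k => squareSum A n (k / 2) + (dyadicDensity A (n + 1) k - dyadicDensity A n (k / 2)) ^ 2

lemma squareSum_nonneg (A : Set UnitIco) (n k : ℕ) : 0 ≤ squareSum A n k := by
  induction n generalizing k with
  | zero => exact le_rfl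
  | succ n ih => exact add_nonneg (ih _) (sq_nonneg _)

lemma sum_sq_dyadicMartingale {A : Set UnitIco} (hA : MeasurableSet A) (N : ℕ) (x : UnitIco) :
    ∑ n ∈ Finset.range N, (dyadicMartingale (A.indicator fun _ => 1) (n + 1) x
      - dyadicMartingale (A.indicator fun _ => 1) n x) ^ 2 = squareSum A N (dyadicIndex N x) := by
  induction N with
  | zero => rfl
  | succ N ih =>
    rw [Finset.sum_range_succ, ih, squareSum, dyadicIndex_succ_div_two,
      dyadicMartingale_indicator hA, dyadicMartingale_indicator hA]

/-- For a dyadic set the square function is eventually a finite sum, and its `L¹` norm is a finite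
average. -/
lemma lpNorm_squareFunction {A : Set UnitIco} (hA : IsDyadicSet A) :
    ∃ N, (∀ k < 2 ^ N, gaussianProfile (dyadicDensity A N k) = 0) ∧
      lpNorm (squareFunction (A.indicator fun _ => 1)) 1 volume
        = (∑ k ∈ Finset.range (2 ^ N), Real.sqrt (squareSum A N k)) / 2 ^ N := by
  classical
  have hm := hA.measurableSet
  obtain ⟨N, hN⟩ := hA.exists_preimage
  refine ⟨N, fun k hk => ?_, ?_⟩
  · obtain ⟨T, hT⟩ := hN N le_rfl
    rw [hT, dyadicDensity_preimage T hk]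
    exact gaussianProfile_of_notMem (by split_ifs <;> simp)
  have hterm : ∀ n ≥ N, ∀ x, dyadicMartingale (A.indicator fun _ => 1) n x
      = A.indicator (fun _ => 1) x := by
    intro n hn x
    obtain ⟨T, hT⟩ := hN n hn
    rw [dyadicMartingale_indicator hm, hT, dyadicDensity_preimage T (dyadicIndex_lt n x)]
    rfl
  have hfun : squareFunction (A.indicator fun _ => 1)
      = fun x => Real.sqrt (squareSum A N (dyadicIndex N x)) := by
    ext x
    rw [squareFunction, tsum_eq_sum (s := Finset.range N), sum_sq_dyadicMartingale hm]
    intro n hn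
    have hn' : N ≤ n := by simpa using hn
    rw [hterm n hn', hterm (n + 1) (by omega), sub_self, zero_pow two_ne_zero]
  have hmeas : Measurable fun x => Real.sqrt (squareSum A N (dyadicIndex N x)) :=
    (measurable_of_countable fun k => Real.sqrt (squareSum A N k)).comp (measurable_dyadicIndex N)
  rw [hfun, lpNorm_one_eq_integral_norm hmeas.aestronglyMeasurable]
  simp_rw [Real.norm_of_nonneg (Real.sqrt_nonneg _)]
  exact integral_comp_dyadicIndex N fun k => Real.sqrt (squareSum A N k)

/-! ### Monotonicity along the martingale -/

/-- The expectation of `√(I(f_n)² + ∑_{m ≤ n} (f_m - f_{m-1})²)`, where `f_n` is the dyadic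
martingale of the indicator of `A` and `I` the Gaussian profile. -/
noncomputable def bobkovEnergy (A : Set UnitIco) (n : ℕ) : ℝ :=
  (∑ k ∈ Finset.range (2 ^ n),
    Real.sqrt (gaussianProfile (dyadicDensity A n k) ^ 2 + squareSum A n k)) / 2 ^ n

lemma sum_range_two_mul (g : ℕ → ℝ) (m : ℕ) :
    ∑ k ∈ Finset.range (2 * m), g k
      = ∑ k ∈ Finset.range m, (g (2 * k) + g (2 * k + 1)) := by
  induction m with
  | zero => rfl
  | succ m ih =>
    rw [Nat.mul_succ, Finset.sum_range_succ, Finset.sum_range_succ, ih, Finset.sum_range_succ]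
    ring

/-- The increment of the energy is nonnegative on every dyadic interval, by the two-point
inequality for the densities `a`, `b` in its two halves, whose distance from their mean is
`|a - b| / 2`. -/
lemma bobkovEnergy_le_succ {A : Set UnitIco} (hA : MeasurableSet A) (n : ℕ) :
    bobkovEnergy A n ≤ bobkovEnergy A (n + 1) := by
  rw [bobkovEnergy, bobkovEnergy, pow_succ' 2 n, sum_range_two_mul, pow_succ' 2 n, ← div_div]
  refine div_le_div_of_nonneg_right ?_ (by positivity)
  rw [Finset.sum_div]
  refine Finset.sum_le_sum fun k _ => ?_
  rw [le_div_iff₀ two_pos, mul_comm]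
  have hd := dyadicDensity_eq_average hA n k
  have h := two_point_add (dyadicDensity_mem_Icc A (n + 1) (2 * k))
    (dyadicDensity_mem_Icc A (n + 1) (2 * k + 1)) (squareSum_nonneg A n k)
  rw [← hd] at h
  refine h.trans_eq ?_
  have e1 : 2 * k / 2 = k := by omega
  have e2 : (2 * k + 1) / 2 = k := by omega
  simp only [squareSum, e1, e2]
  rw [hd]
  ring_nf

/-- The energy starts at `I(|A|)` and ends at the `L¹` norm of the square function. -/
theorem gaussianProfile_le_lpNorm_squareFunction {A : Set UnitIco} (hA : IsDyadicSet A) :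
    gaussianProfile (volume.real A)
      ≤ lpNorm (squareFunction (A.indicator fun _ => (1 : ℝ))) 1 volume := by
  obtain ⟨N, h0, hN⟩ := lpNorm_squareFunction hA
  have hmono := monotone_nat_of_le_succ (bobkovEnergy_le_succ hA.measurableSet) (Nat.zero_le N)
  have hstart : bobkovEnergy A 0 = gaussianProfile (volume.real A) := by
    simp [bobkovEnergy, squareSum, dyadicDensity_zero_zero, Real.sqrt_sq (gaussianProfile_nonneg _)]
  rw [hN, ← hstart]
  refine hmono.trans_eq ?_
  rw [bobkovEnergy]
  congr 1
  refine Finset.sum_congr rfl fun k hk => ?_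
  rw [h0 k (Finset.mem_range.1 hk), zero_pow two_ne_zero, zero_add]

end DyadicSquare

open DyadicSquare in
theorem theorem2p1 :
    (∀ A : Set UnitIco, IsDyadicSet A →
      gaussianProfile (volume.real A) ≤
        lpNorm (squareFunction (A.indicator (fun _ => (1 : ℝ)))) 1 volume) ∧
    (∃ C : ℝ, 0 < C ∧ ∀ A : Set UnitIco, IsDyadicSet A →
      C * (measureStar A * Real.sqrt (Real.log (1 / measureStar A))) ≤
        lpNorm (squareFunction (A.indicator (fun _ => (1 : ℝ)))) 1 volume) :=
  ⟨fun _ hA => gaussianProfile_le_lpNorm_squareFunction hA, 1 / 6, by norm_num, fun _ hA =>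
    (mul_sqrt_log_le_gaussianProfile ⟨measureReal_nonneg, measureReal_le_one⟩).trans
      (gaussianProfile_le_lpNorm_squareFunction hA)⟩
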